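/- Let $m,n\ge 0$ be integers, and let $R_{m,n}$ be the following relations between positive words in the letters $s,t_1,\dots,t_m,u_1,\dots,u_n$: the cyclic relations $[s,t_1,\dots,t_m]$ and $[s,u_1,\dots,u_n]$, and the commutation relations $t_iu_j=u_jt_i$ ($1\le i\le m$, $1\le j\le n$). Here $[x_1,\dots,x_k]$ means that all cyclic rotations of $x_1x_2\cdots x_k$ are equal: $x_1x_2\cdots x_k=x_2\cdots x_kx_1=\dots=x_kx_1\cdots x_{k-1}$. Let $G_{m,n}$ be the group and $G^+_{m,n}$ the monoid presented by these generators and relations, let $\pi:G^+_{m,n}\to G_{m,n}$ be the homomorphism that is the identity on letters, and let $\Delta=s\,t_1\cdots t_m\,u_1\cdots u_n\in G^+_{m,n}$. Proposition 5.2. The word problem in $G_{m,n}$ is solvable: there is an algorithm that decides, for any two group words $U,V$ (finite sequences of letters and inverse letters), whether $U=V$ in $G_{m,n}$. In more detail: (a) There is exactly one permutation $\sigma$ of the letters such that for each letter $x$ there is $\Delta_x\in G^+_{m,n}$ with $\Delta=x\,\Delta_x=\Delta_x\,\sigma(x)$. Put $\Lambda=\Delta^{\mathrm{ord}\,\sigma}$.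 Then $\Lambda$ is central in $G^+_{m,n}$ and $\pi(\Lambda)$ is central in $G_{m,n}$. (b) There is an algorithm that computes, for any two group words $U,V$, an integer $k\ge 0$ and positive words $P,Q$ such that $\pi(P)=\pi(\Lambda)^kU$ and $\pi(Q)=\pi(\Lambda)^kV$ in $G_{m,n}$. (c) Whenever $U,V$ are group words, $k\ge0$, and $P,Q$ are positive words with $\pi(P)=\pi(\Lambda)^kU$ and $\pi(Q)=\pi(\Lambda)^kV$, we have $U=V$ in $G_{m,n}$ if and only if $P=Q$ in $G^+_{m,n}$. (d) There is an algorithm that computes, for any positive word $P$, a finite list of positive words consisting exactly of the positive words that are equal to $P$ in $G^+_{m,n}$. -/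

import Mathlib

/-- The alphabet `s, t_1, …, t_m, u_1, …, u_n`. -/
abbrev Letter (m n : ℕ) : Type := Unit ⊕ (Fin m ⊕ Fin n)

/-- The letter `s`. -/
def sL (m n : ℕ) : Letter m n := Sum.inl ()

/-- The letters `t_1, …, t_m`. -/
def tL (m n : ℕ) (i : Fin m) : Letter m n := Sum.inr (Sum.inl i)

/-- The letters `u_1, …, u_n`. -/
def uL (m n : ℕ) (j : Fin n) : Letter m n := Sum.inr (Sum.inr j)

/-- Positive words: finite sequences of letters. -/
abbrev PosWord (m n : ℕ) : Type := List (Letter m n)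

/-- Group words: finite sequences of signed letters; `(x, true)` is `x`, `(x, false)` is `x⁻¹`. -/
abbrev GroupWord (m n : ℕ) : Type := List (Letter m n × Bool)

/-- The positive word `t_1 ⋯ t_m`. -/
def tWord (m n : ℕ) : PosWord m n := List.ofFn (tL m n)

/-- The positive word `u_1 ⋯ u_n`. -/
def uWord (m n : ℕ) : PosWord m n := List.ofFn (uL m n)

/-- The defining relations: the cyclic relations `[s, t_1, …, t_m]` and `[s, u_1, …, u_n]`
(all cyclic rotations of the word are equal) and the commutation relations `[t_i, u_j]`. -/
inductive DefRel (m n : ℕ) : FreeMonoid (Letter m n) → FreeMonoid (Letter m n) → Prop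
  | cyc_t (k : ℕ) : DefRel m n (FreeMonoid.ofList (sL m n :: tWord m n))
      (FreeMonoid.ofList ((sL m n :: tWord m n).rotate k))
  | cyc_u (k : ℕ) : DefRel m n (FreeMonoid.ofList (sL m n :: uWord m n))
      (FreeMonoid.ofList ((sL m n :: uWord m n).rotate k))
  | comm (i : Fin m) (j : Fin n) : DefRel m n (FreeMonoid.ofList [tL m n i, uL m n j])
      (FreeMonoid.ofList [uL m n j, tL m n i])

/-- The monoid `G⁺_{m,n}` presented by the defining relations. -/
abbrev GPlus (m n : ℕ) : Type := PresentedMonoid (DefRel m n)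

/-- A positive word, viewed in the free group. -/
def freeMonoidToFreeGroup (m n : ℕ) : FreeMonoid (Letter m n) →* FreeGroup (Letter m n) :=
  FreeMonoid.lift FreeGroup.of

/-- The relators `a b⁻¹`, for the defining relations `a = b`. -/
def groupRelators (m n : ℕ) : Set (FreeGroup (Letter m n)) :=
  {r | ∃ a b, DefRel m n a b ∧
    r = freeMonoidToFreeGroup m n a * (freeMonoidToFreeGroup m n b)⁻¹}

/-- The group `G_{m,n}` given by the same presentation. -/
abbrev Gmn (m n : ℕ) : Type := PresentedGroup (groupRelators m n)

/-- The element of `G⁺_{m,n}` represented by a positive word. -/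
def posVal {m n : ℕ} (w : PosWord m n) : GPlus m n :=
  PresentedMonoid.mk (DefRel m n) (FreeMonoid.ofList w)

/-- The element of `G_{m,n}` represented by a group word. -/
def groupVal {m n : ℕ} (w : GroupWord m n) : Gmn m n :=
  PresentedGroup.mk (groupRelators m n) (FreeGroup.mk w)

theorem localization_aux (m n : ℕ) (a b : FreeMonoid (Letter m n)) (h : DefRel m n a b) :
    FreeMonoid.lift (PresentedGroup.of (rels := groupRelators m n)) a =
      FreeMonoid.lift (PresentedGroup.of (rels := groupRelators m n)) b := by
  have key : FreeMonoid.lift (PresentedGroup.of (rels := groupRelators m n)) =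
      (PresentedGroup.mk (groupRelators m n)).comp (freeMonoidToFreeGroup m n) := by
    ext x
    simp [freeMonoidToFreeGroup, PresentedGroup.of]
  rw [key]
  exact PresentedGroup.mk_eq_mk_of_mul_inv_mem ⟨a, b, h, rfl⟩

/-- The localization homomorphism `π : G⁺_{m,n} → G_{m,n}`, which sends each letter to itself. -/
def localizationHom (m n : ℕ) : GPlus m n →* Gmn m n :=
  PresentedMonoid.lift (PresentedGroup.of (rels := groupRelators m n)) (localization_aux m n)

/-- The element `Δ = s t_1 ⋯ t_m u_1 ⋯ u_n` of `G⁺_{m,n}`. -/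
def Delta (m n : ℕ) : GPlus m n := posVal (sL m n :: (tWord m n ++ uWord m n))

/-- `σ` is a permutation of the letters witnessing that `D` is a fundamental element: for each
letter `x` there is `D_x` with `D = x D_x = D_x σ(x)`. (No letter of this alphabet is a dummy
generator: both sides of each relation have the same length, and the only relation between
words of length one is the trivial relation `s = s`, when `m = 0` or `n = 0`.) -/
def IsFundamentalPerm {m n : ℕ} (D : GPlus m n) (σ : Equiv.Perm (Letter m n)) : Prop :=
  ∀ x : Letter m n, ∃ Dx : GPlus m n, D = posVal [x] * Dx ∧ D = Dx * posVal [σ x]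

/-! The core is that π is injective and that equality in `GPlus` has a computable complete
invariant. Deleting the letters u, or the letters t, from a positive word leaves a word over s and
the t's, or over s and the u's. The invariant records the length of each projection and its reduced
form, in which full turns (rotations of s t_1⋯t_m, resp. s u_1⋯u_n) are cancelled.

The invariant depends only on the value in the group: letter counts factor through the
abelianization, and the group acts on cycle-free words, where a full turn acts trivially and the
image of the empty word is the reduced form (`turnReduce_tProj_eq_of_localizationHom_eq`).
Conversely, a word is determined by its two projections (`posVal_eq_of_proj_eq`), and one turn in a
projection can be exchanged for another without changing the monoid element or the other projection
(`LiftsTo.turn`). Since length and reduced form classify words up to such exchanges, equal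
invariants give equal monoid elements (`posVal_eq_of_invariants_eq`).

Each letter divides Δ on both sides with the same cofactor, so Δ is central, σ = 1 and Λ = Δ.
Replacing inverse letters by cofactors turns group words into positive ones, and comparing
invariants decides equality. -/

/-! ### Cancellation of full cycles and its action on cycle-free words -/

section CyclicStack

variable {α : Type*} (nx : α → α) (m : ℕ)

/-- The word has no factor that is a full cycle. -/
def CycleFree (w : List α) : Prop :=
  ∀ x, ¬ List.iterate nx x (m + 1) <:+: w

variable {nx m}

theorem CycleFree.of_infix {v w : List α} (hw : CycleFree nx m w) (h : v <:+: w) :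
    CycleFree nx m v :=
  fun x hx => hw x (hx.trans h)

theorem cycleFree_nil : CycleFree nx m [] := by
  intro x hx
  simpa using hx.length_le

variable [DecidableEq α]

/-- Put the letter `x` in front of the word `w`; if this completes a full cycle
`x, nx x, …, nx^[m] x`, cancel that cycle. -/
def cyclePush (nx : α → α) (m : ℕ) (x : α) (w : List α) : List α :=
  -- This equality says that `w` begins with the `m` letters that follow `x` in the cycle.
  if List.iterate nx (nx x) m ++ w.drop m = w then w.drop m else x :: w

theorem cyclePush_append (x : α) (w : List α) :
    cyclePush nx m x (List.iterate nx (nx x) m ++ w) = w := by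
  simp [cyclePush, List.length_iterate]

theorem cyclePush_of_not_prefix {x : α} {w : List α}
    (h : ¬ List.iterate nx (nx x) m <+: w) : cyclePush nx m x w = x :: w := by
  rw [cyclePush, if_neg]
  intro h'
  exact h ⟨_, h'⟩

theorem CycleFree.cyclePush_eq_cons {x : α} {w : List α} (h : CycleFree nx m (x :: w)) :
    cyclePush nx m x w = x :: w := by
  apply cyclePush_of_not_prefix
  rintro ⟨v, rfl⟩
  exact h x ⟨[], v, by simp [List.iterate]⟩

theorem CycleFree.cyclePush {w : List α} (hw : CycleFree nx m w) (x : α) :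
    CycleFree nx m (cyclePush nx m x w) := by
  by_cases h : List.iterate nx (nx x) m <+: w
  · obtain ⟨v, rfl⟩ := h
    rw [cyclePush_append]
    exact hw.of_infix (List.suffix_append _ _).isInfix
  · rw [cyclePush_of_not_prefix h]
    intro y hy
    rcases List.infix_cons_iff.1 hy with hy | hy
    · rw [List.iterate, List.cons_prefix_cons] at hy
      obtain ⟨rfl, hy'⟩ := hy
      exact h hy'
    · exact hw y hy

theorem CycleFree.foldr_cyclePush {a w : List α} (h : CycleFree nx m (a ++ w)) :
    a.foldr (_root_.cyclePush nx m) w = a ++ w := by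
  induction a with
  | nil => rfl
  | cons x a ih =>
    rw [List.foldr_cons, ih (h.of_infix (List.suffix_cons _ _).isInfix)]
    exact h.cyclePush_eq_cons

theorem CycleFree.foldr {w : List α} (hw : CycleFree nx m w) (a : List α) :
    CycleFree nx m (a.foldr (_root_.cyclePush nx m) w) := by
  induction a with
  | nil => exact hw
  | cons x a ih => exact ih.cyclePush x

/-- No cancellation can occur: it would need `m` successive letters at the top of the stack, and
dropping the `j` letters above `x` would leave the prefix that `hmax` excludes. -/
theorem foldr_cyclePush_iterate_aux {x : α} {r : ℕ} {w : List α}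
    (hmax : ¬ List.iterate nx x (r + 1) <+: List.iterate nx x r ++ w) (j : ℕ) (y : α)
    (hy : nx^[j] y = x) (hj : j + r ≤ m) :
    (List.iterate nx y j).foldr (cyclePush nx m) (List.iterate nx x r ++ w) =
      List.iterate nx y (j + r) ++ w := by
  induction j generalizing y with
  | zero =>
    obtain rfl : y = x := hy
    simp [List.iterate]
  | succ j ih =>
    rw [List.iterate, List.foldr_cons, ih (nx y) hy (by omega), cyclePush_of_not_prefix,
      Nat.succ_add, List.iterate, List.cons_append]
    intro h
    apply hmax
    have hx : nx^[j] (nx y) = x := hy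
    have e : m = j + ((r + 1) + (m - (j + r + 1))) := by omega
    rw [e, List.iterate_add, List.iterate_add nx _ j r, hx, List.append_assoc,
      List.prefix_append_right_inj, List.iterate_add] at h
    exact (List.prefix_append _ _).trans h

/-- A full cycle acts trivially on cycle-free words. -/
theorem CycleFree.foldr_iterate (hnx : ∀ x, nx^[m + 1] x = x) {w : List α}
    (hw : CycleFree nx m w) (x : α) :
    (List.iterate nx x (m + 1)).foldr (_root_.cyclePush nx m) w = w := by
  classical
  have h0 : ∃ r, ¬ List.iterate nx x (r + 1) <+: w := ⟨m, fun h => hw x h.isInfix⟩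
  -- Let `r` be the length of the longest initial part of the turn that is a prefix of `w`, and
  -- write `v` for the rest of `w`. The last `m - r` letters of the turn, pushed first, pile up
  -- without cancelling; the next letter completes a cycle and leaves `v`; the first `r` letters
  -- then rebuild `w`.
  obtain ⟨r, hrm, hpre, hmax⟩ : ∃ r ≤ m, List.iterate nx x r <+: w ∧
      ¬ List.iterate nx x (r + 1) <+: w := by
    refine ⟨Nat.find h0, Nat.find_min' h0 fun h => hw x h.isInfix, ?_, Nat.find_spec h0⟩
    rcases Nat.eq_zero_or_pos (Nat.find h0) with h | h
    · rw [h]; exact List.nil_prefix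
    · have := Nat.find_min h0 (m := Nat.find h0 - 1) (by omega)
      rwa [not_not, Nat.sub_add_cancel h] at this
  obtain ⟨v, rfl⟩ := hpre
  have e : m + 1 = r + ((m - r) + 1) := by omega
  have hx : nx^[m - r] (nx (nx^[r] x)) = x := by
    rw [← Function.iterate_succ_apply' nx r, ← Function.iterate_add_apply]
    have : m - r + (r + 1) = m + 1 := by omega
    rw [this, hnx]
  have key := foldr_cyclePush_iterate_aux (m := m) hmax (m - r) (nx (nx^[r] x)) hx (by omega)
  conv_lhs => rw [e]
  rw [List.iterate_add, List.foldr_append, List.iterate, List.foldr_cons, key,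
    Nat.sub_add_cancel hrm, cyclePush_append]
  exact hw.foldr_cyclePush

/-- Pushing the other `m` letters of the cycle inverts pushing `x`, on both sides, because the turns
starting at `nx x` and at `x` both act trivially. -/
theorem cyclePush_bijective (hnx : ∀ x, nx^[m + 1] x = x) (x : α) :
    Function.Bijective (fun w : {w : List α // CycleFree nx m w} =>
      (⟨cyclePush nx m x w.1, w.2.cyclePush x⟩ : {w : List α // CycleFree nx m w})) := by
  constructor
  · intro v w h
    have h' := congrArg (fun z : {w : List α // CycleFree nx m w} =>
      (List.iterate nx (nx x) m).foldr (cyclePush nx m) z.1) h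
    have e : ∀ w : {w : List α // CycleFree nx m w},
        (List.iterate nx (nx x) m).foldr (cyclePush nx m) (cyclePush nx m x w.1) = w.1 := by
      intro w
      have := w.2.foldr_iterate hnx (nx x)
      rw [List.iterate_add, List.foldr_append] at this
      rw [← Function.iterate_succ_apply nx m, hnx x] at this
      exact this
    simp only [e] at h'
    exact Subtype.ext h'
  · intro w
    exact ⟨⟨_, w.2.foldr (List.iterate nx (nx x) m)⟩, Subtype.ext (w.2.foldr_iterate hnx x)⟩

/-- The permutation of the cycle-free words given by a letter. -/
noncomputable def cyclePerm (hnx : ∀ x, nx^[m + 1] x = x) (x : α) :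
    Equiv.Perm {w : List α // CycleFree nx m w} :=
  Equiv.ofBijective _ (cyclePush_bijective hnx x)

theorem cyclePerm_list_prod (hnx : ∀ x, nx^[m + 1] x = x) (a : List α)
    (w : {w : List α // CycleFree nx m w}) :
    ((a.map (cyclePerm hnx)).prod w).1 = a.foldr (cyclePush nx m) w.1 := by
  induction a with
  | nil => rfl
  | cons x a ih =>
    rw [List.map_cons, List.prod_cons, List.foldr_cons, ← ih]
    rfl

theorem cyclePerm_iterate_prod (hnx : ∀ x, nx^[m + 1] x = x) (x : α) :
    ((List.iterate nx x (m + 1)).map (cyclePerm hnx)).prod = 1 := by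
  ext1 w
  apply Subtype.ext
  rw [cyclePerm_list_prod, w.2.foldr_iterate hnx]
  rfl

variable {M : Type*} [Monoid M]

/-- The turns from `x` and from `nx x` have the same product `D`, so `D` commutes with each `f x`
and every cancelled cycle can be pulled out in front. The length equation determines `k`. -/
theorem exists_list_prod_eq_pow_mul_foldr (hnx : ∀ x, nx^[m + 1] x = x) (f : α → M)
    (D : M) (hf : ∀ x, ((List.iterate nx x (m + 1)).map f).prod = D) (a : List α) :
    ∃ k, (a.map f).prod = D ^ k * ((a.foldr (cyclePush nx m) []).map f).prod ∧
      a.length = k * (m + 1) + (a.foldr (cyclePush nx m) []).length := by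
  have hcomm : ∀ x, Commute (f x) D := by
    intro x
    have h1 := hf (nx x)
    rw [List.iterate_add, ← Function.iterate_succ_apply nx m, hnx x] at h1
    have h2 := hf x
    simp only [List.iterate, List.map_cons, List.prod_cons, List.map_append, List.prod_append,
      List.map_nil, List.prod_nil, mul_one] at h1 h2
    calc f x * D = f x * (((List.iterate nx (nx x) m).map f).prod * f x) := by rw [h1]
      _ = D * f x := by rw [← mul_assoc, h2]
  induction a with
  | nil => exact ⟨0, by simp⟩
  | cons x a ih =>
    obtain ⟨k, hk, hl⟩ := ih
    rw [List.foldr_cons]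
    set w := a.foldr (cyclePush nx m) []
    by_cases h : List.iterate nx (nx x) m <+: w
    · obtain ⟨v, hv⟩ := h
      refine ⟨k + 1, ?_, ?_⟩
      · rw [← hv, cyclePush_append, List.map_cons, List.prod_cons, hk, ← hv, List.map_append,
          List.prod_append, ← mul_assoc, ((hcomm x).pow_right k).eq, pow_succ, mul_assoc,
          mul_assoc]
        have h2 := hf x
        simp only [List.iterate, List.map_cons, List.prod_cons] at h2
        rw [← mul_assoc (f x), h2]
      · rw [← hv, cyclePush_append, List.length_cons, hl, ← hv, List.length_append,
          List.length_iterate]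
        ring
    · refine ⟨k, ?_, ?_⟩
      · rw [cyclePush_of_not_prefix h, List.map_cons, List.prod_cons, List.map_cons,
          List.prod_cons, hk, ← mul_assoc, ((hcomm x).pow_right k).eq, mul_assoc]
      · rw [cyclePush_of_not_prefix h, List.length_cons, List.length_cons, hl, add_assoc]

/-- If all full cycles have the same value, then the value of a word is determined by its length
and by its action on the empty word. -/
theorem list_prod_eq_of_foldr_cyclePush_eq (hnx : ∀ x, nx^[m + 1] x = x) (f : α → M)
    (D : M) (hf : ∀ x, ((List.iterate nx x (m + 1)).map f).prod = D) {a b : List α}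
    (hl : a.length = b.length)
    (h : a.foldr (cyclePush nx m) [] = b.foldr (cyclePush nx m) []) :
    (a.map f).prod = (b.map f).prod := by
  obtain ⟨k, hk, hka⟩ := exists_list_prod_eq_pow_mul_foldr hnx f D hf a
  obtain ⟨l, hl', hlb⟩ := exists_list_prod_eq_pow_mul_foldr hnx f D hf b
  have hkl : k = l := by
    rw [hl, hlb, h] at hka
    exact (Nat.eq_of_mul_eq_mul_right (Nat.succ_pos m) (Nat.add_right_cancel hka)).symm
  rw [hk, hl', h, hkl]

end CyclicStack

/-! ### Turns as rotations of the list of indices -/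

section Cycles

/-- The cyclic successor on the indices of `s, t_1, …, t_m`. -/
def cycSucc (m : ℕ) (x : Fin (m + 1)) : Fin (m + 1) := x + 1

theorem val_iterate_cycSucc (m k : ℕ) (x : Fin (m + 1)) :
    ((cycSucc m)^[k] x).val = (x.val + k) % (m + 1) := by
  induction k with
  | zero => simp [Nat.mod_eq_of_lt x.2]
  | succ k ih =>
    rw [Function.iterate_succ_apply', cycSucc, Fin.val_add, ih, Fin.val_one', ← Nat.add_mod,
      add_assoc]

theorem iterate_cycSucc_self (m : ℕ) (x : Fin (m + 1)) : (cycSucc m)^[m + 1] x = x := by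
  apply Fin.ext
  rw [val_iterate_cycSucc, Nat.add_mod_right, Nat.mod_eq_of_lt x.2]

theorem iterate_cycSucc_zero (m : ℕ) (x : Fin (m + 1)) : (cycSucc m)^[x.val] 0 = x := by
  apply Fin.ext
  rw [val_iterate_cycSucc, Fin.val_zero, zero_add, Nat.mod_eq_of_lt x.2]

theorem rotate_list_iterate {α : Type*} {nx : α → α} {m : ℕ} (hnx : ∀ x, nx^[m + 1] x = x)
    (x : α) (k : ℕ) :
    (List.iterate nx x (m + 1)).rotate k = List.iterate nx (nx^[k] x) (m + 1) := by
  induction k generalizing x with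
  | zero => simp
  | succ k ih =>
    rw [Function.iterate_succ_apply, ← ih (nx x), List.iterate, List.rotate_cons_succ,
      List.iterate_add, ← Function.iterate_succ_apply nx m, hnx x]
    rfl

/-- The word of one turn through all indices, starting at `x`. -/
def turn (m : ℕ) (x : Fin (m + 1)) : List (Fin (m + 1)) :=
  List.iterate (cycSucc m) x (m + 1)

theorem turn_zero (m : ℕ) : turn m 0 = List.finRange (m + 1) := by
  apply List.ext_getElem
  · simp [turn, List.length_iterate]
  · intro i h1 h2
    have hi : i < m + 1 := by simpa using h2
    simp only [turn, List.getElem_iterate, List.getElem_finRange]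
    apply Fin.ext
    rw [val_iterate_cycSucc]
    simp [Nat.mod_eq_of_lt hi]

theorem turn_eq_rotate (m : ℕ) (x : Fin (m + 1)) :
    turn m x = (List.finRange (m + 1)).rotate x.val := by
  rw [← turn_zero, turn, turn, rotate_list_iterate (iterate_cycSucc_self m), iterate_cycSucc_zero]

theorem turn_perm (m : ℕ) (x : Fin (m + 1)) : (turn m x).Perm (List.finRange (m + 1)) := by
  rw [turn_eq_rotate]
  exact List.rotate_perm _ _

end Cycles

/-! ### The two projections of a positive word -/

section Projections

variable {m n : ℕ}

/-- The letters `s, t_1, …, t_m` by their indices. -/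
def stLetter (m n : ℕ) (x : Fin (m + 1)) : Letter m n := Fin.cases (sL m n) (tL m n) x

/-- The index of a letter among `s, t_1, …, t_m`. -/
def stIndex (m n : ℕ) : Letter m n → Option (Fin (m + 1))
  | Sum.inl _ => some 0
  | Sum.inr (Sum.inl i) => some i.succ
  | Sum.inr (Sum.inr _) => none

/-- Exchange of the letters `t_i` and `u_j`. -/
def swapLetter (m n : ℕ) : Letter m n → Letter n m := Sum.map id Sum.swap

/-- The word in `s, t_1, …, t_m` obtained by deleting the letters `u_j`. -/
def tProj (w : PosWord m n) : List (Fin (m + 1)) := w.filterMap (stIndex m n)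

/-- The word in `s, u_1, …, u_n` obtained by deleting the letters `t_i`. -/
def uProj (w : PosWord m n) : List (Fin (n + 1)) := tProj (w.map (swapLetter m n))

@[simp] theorem stIndex_s : stIndex m n (sL m n) = some 0 := rfl
@[simp] theorem stIndex_t (i : Fin m) : stIndex m n (tL m n i) = some i.succ := rfl
@[simp] theorem stIndex_u (j : Fin n) : stIndex m n (uL m n j) = none := rfl
@[simp] theorem swapLetter_s : swapLetter m n (sL m n) = sL n m := rfl
@[simp] theorem swapLetter_t (i : Fin m) : swapLetter m n (tL m n i) = uL n m i := rfl
@[simp] theorem swapLetter_u (j : Fin n) : swapLetter m n (uL m n j) = tL n m j := rfl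
@[simp] theorem stLetter_zero : stLetter m n 0 = sL m n := rfl
@[simp] theorem stLetter_succ (i : Fin m) : stLetter m n i.succ = tL m n i := rfl

theorem stIndex_stLetter (x : Fin (m + 1)) : stIndex m n (stLetter m n x) = some x := by
  cases x using Fin.cases <;> rfl

theorem swapLetter_swapLetter (x : Letter m n) :
    swapLetter n m (swapLetter m n x) = x := by
  rcases x with _ | _ | _ <;> rfl

theorem map_swapLetter_map_swapLetter (w : PosWord m n) :
    (w.map (swapLetter m n)).map (swapLetter n m) = w := by
  simp [List.map_map, Function.comp_def, swapLetter_swapLetter]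

theorem letter_cases {motive : Letter m n → Prop} (x : Letter m n) (s : motive (sL m n))
    (t : ∀ i, motive (tL m n i)) (u : ∀ j, motive (uL m n j)) : motive x := by
  rcases x with _ | i | j
  exacts [s, t i, u j]

@[simp] theorem tProj_append (v w : PosWord m n) : tProj (v ++ w) = tProj v ++ tProj w :=
  List.filterMap_append

@[simp] theorem uProj_append (v w : PosWord m n) : uProj (v ++ w) = uProj v ++ uProj w := by
  simp [uProj]

@[simp] theorem tProj_nil : tProj ([] : PosWord m n) = [] := rfl
@[simp] theorem uProj_nil : uProj ([] : PosWord m n) = [] := rfl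
@[simp] theorem tProj_s_cons (w : PosWord m n) : tProj (sL m n :: w) = 0 :: tProj w := rfl
@[simp] theorem tProj_t_cons (i : Fin m) (w : PosWord m n) :
    tProj (tL m n i :: w) = i.succ :: tProj w := rfl
@[simp] theorem tProj_u_cons (j : Fin n) (w : PosWord m n) :
    tProj (uL m n j :: w) = tProj w := rfl
@[simp] theorem uProj_s_cons (w : PosWord m n) : uProj (sL m n :: w) = 0 :: uProj w := rfl
@[simp] theorem uProj_t_cons (i : Fin m) (w : PosWord m n) :
    uProj (tL m n i :: w) = uProj w := rfl
@[simp] theorem uProj_u_cons (j : Fin n) (w : PosWord m n) :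
    uProj (uL m n j :: w) = j.succ :: uProj w := rfl

theorem tProj_map_stLetter (a : List (Fin (m + 1))) : tProj (a.map (stLetter m n)) = a := by
  rw [tProj, List.filterMap_map]
  simp [stIndex_stLetter]

theorem tProj_map_u (a : List (Fin n)) : tProj (a.map (uL m n)) = [] := by
  induction a with
  | nil => rfl
  | cons j a ih => simpa using ih

theorem uProj_map_t (a : List (Fin m)) : uProj (a.map (tL m n)) = [] := by
  induction a with
  | nil => rfl
  | cons j a ih => simpa using ih

theorem uProj_map_u (a : List (Fin n)) : uProj (a.map (uL m n)) = a.map Fin.succ := by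
  induction a with
  | nil => rfl
  | cons j a ih => simpa using ih

theorem s_cons_tWord : sL m n :: tWord m n = (List.finRange (m + 1)).map (stLetter m n) := by
  rw [List.finRange_succ, List.map_cons, List.map_map, tWord, List.ofFn_eq_map]
  rfl

theorem s_cons_tWord_rotate (k : ℕ) : ∃ x, (sL m n :: tWord m n).rotate k =
    (turn m x).map (stLetter m n) := by
  refine ⟨(cycSucc m)^[k] 0, ?_⟩
  rw [s_cons_tWord, ← turn_zero, ← List.map_rotate, turn, turn,
    rotate_list_iterate (iterate_cycSucc_self m)]

/-- A turn has exactly one s and no u, and a permutation of a one-letter list is that list. -/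
theorem uProj_map_turn (x : Fin (m + 1)) : uProj ((turn m x).map (stLetter m n)) = [0] := by
  have h : (uProj ((turn m x).map (stLetter m n))).Perm
      (uProj (sL m n :: tWord m n)) := by
    rw [s_cons_tWord]
    exact (((turn_perm m x).map _).map _).filterMap _
  have e : uProj (sL m n :: tWord m n) = [0] := by
    rw [uProj_s_cons, tWord, List.ofFn_eq_map, uProj_map_t]
  rwa [e, List.perm_singleton] at h

end Projections

/-! ### Equal invariants imply equality in the monoid -/

section Monoid

variable {m n : ℕ}

theorem posVal_append (v w : PosWord m n) : posVal (v ++ w) = posVal v * posVal w :=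
  map_mul (PresentedMonoid.mk (DefRel m n)) (FreeMonoid.ofList v) (FreeMonoid.ofList w)

theorem posVal_nil : posVal ([] : PosWord m n) = 1 := rfl

theorem posVal_cons (x : Letter m n) (w : PosWord m n) :
    posVal (x :: w) = posVal [x] * posVal w := posVal_append [x] w

theorem posVal_eq_of_defRel {a b : FreeMonoid (Letter m n)} (h : DefRel m n a b) :
    posVal a.toList = posVal b.toList :=
  (Con.eq _).2 (ConGen.Rel.of _ _ h)

theorem posVal_surjective : Function.Surjective (posVal : PosWord m n → GPlus m n) :=
  fun x => PresentedMonoid.inductionOn x fun a => ⟨a.toList, rfl⟩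

theorem commute_t_u (i : Fin m) (j : Fin n) :
    Commute (posVal [tL m n i]) (posVal [uL m n j]) := by
  have := posVal_eq_of_defRel (DefRel.comm (m := m) (n := n) i j)
  exact (posVal_append [tL m n i] [uL m n j]).symm.trans
    (this.trans (posVal_append [uL m n j] [tL m n i]))

theorem commute_map_t_map_u (a : List (Fin m)) (b : List (Fin n)) :
    Commute (posVal (a.map (tL m n))) (posVal (b.map (uL m n))) := by
  induction a with
  | nil => exact Commute.one_left _
  | cons i a ih =>
    rw [List.map_cons, posVal_cons]
    refine Commute.mul_left ?_ ih
    clear ih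
    induction b with
    | nil => exact Commute.one_right _
    | cons j b ih =>
      rw [List.map_cons, posVal_cons]
      exact (commute_t_u i j).mul_right ih

theorem posVal_s_cons_tWord_rotate (k : ℕ) :
    posVal ((sL m n :: tWord m n).rotate k) = posVal (sL m n :: tWord m n) :=
  (posVal_eq_of_defRel (DefRel.cyc_t k)).symm

theorem posVal_s_cons_uWord_rotate (k : ℕ) :
    posVal ((sL m n :: uWord m n).rotate k) = posVal (sL m n :: uWord m n) :=
  (posVal_eq_of_defRel (DefRel.cyc_u k)).symm

theorem posVal_map_turn (x : Fin (m + 1)) :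
    posVal ((turn m x).map (stLetter m n)) = posVal (sL m n :: tWord m n) := by
  rw [turn_eq_rotate, List.map_rotate, ← s_cons_tWord, posVal_s_cons_tWord_rotate]

theorem map_swapLetter_tWord : (tWord m n).map (swapLetter m n) = uWord n m := by
  simp [tWord, uWord, List.map_ofFn, Function.comp_def]

theorem map_swapLetter_uWord : (uWord m n).map (swapLetter m n) = tWord n m := by
  simp [tWord, uWord, List.map_ofFn, Function.comp_def]

theorem posVal_map_swapLetter_of_defRel {a b : FreeMonoid (Letter m n)} (h : DefRel m n a b) :
    posVal (a.toList.map (swapLetter m n)) = posVal (b.toList.map (swapLetter m n)) := by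
  cases h with
  | cyc_t k =>
    simp only [FreeMonoid.toList_ofList, List.map_rotate, List.map_cons, map_swapLetter_tWord,
      swapLetter_s, posVal_s_cons_uWord_rotate]
  | cyc_u k =>
    simp only [FreeMonoid.toList_ofList, List.map_rotate, List.map_cons, map_swapLetter_uWord,
      swapLetter_s, posVal_s_cons_tWord_rotate]
  | comm i j => exact (posVal_eq_of_defRel (DefRel.comm j i)).symm

theorem freeMonoid_lift_ofList {M : Type*} [Monoid M] (f : Letter m n → M) (w : PosWord m n) :
    FreeMonoid.lift f (FreeMonoid.ofList w) = (w.map f).prod :=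
  FreeMonoid.lift_apply f _

theorem posVal_eq_prod (w : PosWord m n) : posVal w = (w.map fun x => posVal [x]).prod := by
  induction w with
  | nil => rfl
  | cons x w ih => rw [posVal_cons, ih, List.map_cons, List.prod_cons]

theorem posVal_map_swapLetter {v w : PosWord m n} (h : posVal v = posVal w) :
    posVal (v.map (swapLetter m n)) = posVal (w.map (swapLetter m n)) := by
  have hl : ∀ a b, DefRel m n a b →
      FreeMonoid.lift (fun x => posVal [swapLetter m n x]) a =
        FreeMonoid.lift (fun x => posVal [swapLetter m n x]) b := by
    intro a b hab
    have := posVal_map_swapLetter_of_defRel hab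
    rw [posVal_eq_prod, posVal_eq_prod, List.map_map, List.map_map] at this
    exact (freeMonoid_lift_ofList _ a.toList).trans
      (this.trans (freeMonoid_lift_ofList _ b.toList).symm)
  have h' := congrArg (PresentedMonoid.lift _ hl) h
  have e : ∀ w : PosWord m n, PresentedMonoid.lift _ hl (posVal w) =
      posVal (w.map (swapLetter m n)) := by
    intro w
    rw [posVal_eq_prod (w.map _), List.map_map]
    exact freeMonoid_lift_ofList _ w
  rwa [e, e] at h'

theorem exists_separation (P : PosWord m n) (hP : sL m n ∉ P) :
    ∃ (a : List (Fin m)) (b : List (Fin n)), tProj P = a.map Fin.succ ∧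
      uProj P = b.map Fin.succ ∧
      posVal P = posVal (a.map (tL m n)) * posVal (b.map (uL m n)) := by
  induction P with
  | nil => exact ⟨[], [], rfl, rfl, rfl⟩
  | cons x P ih =>
    obtain ⟨a, b, ha, hb, h⟩ := ih fun h' => hP (List.mem_cons_of_mem _ h')
    induction x using letter_cases with
    | s => exact absurd List.mem_cons_self hP
    | t i =>
      refine ⟨i :: a, b, by simp [ha], by simp [hb], ?_⟩
      rw [posVal_cons, h, List.map_cons, posVal_cons _ (a.map _), mul_assoc]
    | u j =>
      refine ⟨a, j :: b, by simp [ha], by simp [hb], ?_⟩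
      rw [posVal_cons, h, List.map_cons, posVal_cons _ (b.map _), ← mul_assoc, ← mul_assoc]
      exact congrArg (· * _) (commute_map_t_map_u a [j]).eq.symm

/-- A word is determined in the monoid by its two projections. -/
theorem posVal_eq_of_proj_eq {P Q : PosWord m n} (ht : tProj P = tProj Q)
    (hu : uProj P = uProj Q) : posVal P = posVal Q := by
  have hnone : ∀ l : PosWord m n, (∀ x ∈ l, stIndex m n x = none) →
      ∃ b : List (Fin n), l = b.map (uL m n) := by
    intro l hl
    induction l with
    | nil => exact ⟨[], rfl⟩
    | cons x l ih =>
      obtain ⟨b, rfl⟩ := ih fun y hy => hl y (List.mem_cons_of_mem _ hy)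
      have hx := hl x List.mem_cons_self
      induction x using letter_cases with
      | s => simp at hx
      | t i => simp at hx
      | u j => exact ⟨j :: b, rfl⟩
  have hnone' : ∀ l : PosWord m n, (∀ x ∈ l, stIndex n m (swapLetter m n x) = none) →
      ∃ b : List (Fin m), l = b.map (tL m n) := by
    intro l hl
    induction l with
    | nil => exact ⟨[], rfl⟩
    | cons x l ih =>
      obtain ⟨b, rfl⟩ := ih fun y hy => hl y (List.mem_cons_of_mem _ hy)
      have hx := hl x List.mem_cons_self
      induction x using letter_cases with
      | s => simp at hx
      | t i => exact ⟨i :: b, rfl⟩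
      | u j => simp at hx
  induction P generalizing Q with
  | nil =>
    cases Q with
    | nil => rfl
    | cons y Q => induction y using letter_cases <;> simp_all
  | cons x P ih =>
    induction x using letter_cases with
    | s =>
      -- All letters of `Q` ahead of its first s or t are u's. Here there are none, since the second
      -- projection also starts with s.
      obtain ⟨l₁, y, l₂, rfl, h1, h2, h3⟩ := List.filterMap_eq_cons_iff.1 ht.symm
      obtain ⟨b, rfl⟩ := hnone l₁ h1
      induction y using letter_cases with
      | s =>
        cases b with
        | nil =>
          rw [posVal_cons, ih (Q := l₂) h3.symm (by simpa using hu), ← posVal_cons]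
          rfl
        | cons j b => simp [(Fin.succ_ne_zero j).symm] at hu
      | t i => simp at h2
      | u j => simp at h2
    | t i =>
      obtain ⟨l₁, y, l₂, rfl, h1, h2, h3⟩ := List.filterMap_eq_cons_iff.1 ht.symm
      obtain ⟨b, rfl⟩ := hnone l₁ h1
      induction y using letter_cases with
      | s => simp [(Fin.succ_ne_zero i).symm] at h2
      | t k =>
        obtain rfl : k = i := by simpa using h2
        -- The matching t in `Q` is preceded only by u's and commutes to the front.
        rw [posVal_cons, ih (Q := b.map (uL m n) ++ l₂), posVal_append, posVal_append,
          posVal_cons _ l₂, ← mul_assoc, ← mul_assoc]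
        · exact congrArg (· * posVal l₂) (commute_map_t_map_u [k] b)
        · rw [tProj_append, tProj_map_u]
          exact h3.symm
        · simpa using hu
      | u j => simp at h2
    | u j =>
      rw [uProj_u_cons, eq_comm, uProj, tProj, List.filterMap_map] at hu
      obtain ⟨l₁, y, l₂, rfl, h1, h2, h3⟩ := List.filterMap_eq_cons_iff.1 hu
      obtain ⟨b, rfl⟩ := hnone' l₁ h1
      induction y using letter_cases with
      | s => simp [(Fin.succ_ne_zero j).symm] at h2
      | t i => simp at h2
      | u k =>
        obtain rfl : k = j := by simpa using h2
        rw [posVal_cons, ih (Q := b.map (tL m n) ++ l₂), posVal_append, posVal_append,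
          posVal_cons _ l₂, ← mul_assoc, ← mul_assoc]
        · exact congrArg (· * posVal l₂) (commute_map_t_map_u b [k]).symm
        · simpa using ht
        · rw [uProj_append, uProj_map_t, List.nil_append, ← h3, uProj, tProj,
            List.filterMap_map]

/-- Each word with first projection `a` is equal in the monoid to a word with first projection `b`
and the same second projection. -/
def LiftsTo (m n : ℕ) (a b : List (Fin (m + 1))) : Prop :=
  ∀ P : PosWord m n, tProj P = a → ∃ Q, tProj Q = b ∧ uProj Q = uProj P ∧ posVal Q = posVal P

theorem LiftsTo.refl (a : List (Fin (m + 1))) : LiftsTo m n a a :=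
  fun P hP => ⟨P, hP, rfl, rfl⟩

theorem LiftsTo.trans {a b c : List (Fin (m + 1))} (hab : LiftsTo m n a b)
    (hbc : LiftsTo m n b c) : LiftsTo m n a c := by
  intro P hP
  obtain ⟨Q, hQ, hu, hv⟩ := hab P hP
  obtain ⟨R, hR, hu', hv'⟩ := hbc Q hQ
  exact ⟨R, hR, hu'.trans hu, hv'.trans hv⟩

theorem LiftsTo.append {a b c d : List (Fin (m + 1))} (hab : LiftsTo m n a b)
    (hcd : LiftsTo m n c d) : LiftsTo m n (a ++ c) (b ++ d) := by
  intro P hP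
  obtain ⟨P₁, P₂, rfl, h1, h2⟩ := List.filterMap_eq_append_iff.1 hP
  obtain ⟨Q₁, hQ, hu, hv⟩ := hab P₁ h1
  obtain ⟨Q₂, hQ', hu', hv'⟩ := hcd P₂ h2
  exact ⟨Q₁ ++ Q₂, by rw [tProj_append, hQ, hQ'], by rw [uProj_append, uProj_append, hu, hu'],
    by rw [posVal_append, posVal_append, hv, hv']⟩

/-- Such a word contains a single s. The u's before it slide to the far left and those after it to
the far right, past t's only. What remains in the middle is a turn, which a cyclic relation replaces
by the other turn; the second projection still reads: left u's, s, right u's. -/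
theorem LiftsTo.turn (x y : Fin (m + 1)) : LiftsTo m n (turn m x) (turn m y) := by
  intro P hP
  have hnd : (_root_.turn m x).Nodup := (turn_perm m x).nodup_iff.2 (List.nodup_finRange _)
  obtain ⟨A, B, hAB⟩ := List.append_of_mem
    ((turn_perm m x).mem_iff.2 (List.mem_finRange (0 : Fin (m + 1))))
  have hA : (0 : Fin (m + 1)) ∉ A ∧ 0 ∉ B := by
    rw [hAB, List.nodup_append] at hnd
    exact ⟨fun h => hnd.2.2 0 h 0 List.mem_cons_self rfl, (List.nodup_cons.1 hnd.2.1).1⟩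
  have hs : ∀ (w : PosWord m n) (C : List (Fin (m + 1))), tProj w = C → (0 : Fin (m + 1)) ∉ C →
      sL m n ∉ w := by
    rintro w C rfl h hw
    exact h (List.mem_filterMap.2 ⟨_, hw, rfl⟩)
  rw [hAB] at hP
  obtain ⟨P₁, P₂, rfl, h1, h2⟩ := List.filterMap_eq_append_iff.1 hP
  obtain ⟨l₁, z, l₂, rfl, h3, h4, h5⟩ := List.filterMap_eq_cons_iff.1 h2
  have hz : z = sL m n := by
    induction z using letter_cases with
    | s => rfl
    | t i => simp at h4
    | u j => simp at h4
  subst hz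
  have h6 : tProj (P₁ ++ l₁) = A := by
    rw [tProj_append, tProj, tProj, h1, List.filterMap_eq_nil_iff.2 h3, List.append_nil]
  obtain ⟨a, b, ha, hb, hab⟩ := exists_separation _ (hs _ _ h6 hA.1)
  obtain ⟨c, d, hc, hd, hcd⟩ := exists_separation _ (hs _ _ h5 hA.2)
  have key : posVal (a.map (tL m n)) * (posVal [sL m n] * posVal (c.map (tL m n))) =
      posVal ((_root_.turn m y).map (stLetter m n)) := by
    rw [posVal_map_turn, ← posVal_map_turn x, hAB, ← h6, ha, ← h5, ← tProj, hc, ← posVal_cons,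
      ← posVal_append]
    congr 1
    simp [Function.comp_def]
  refine ⟨b.map (uL m n) ++ ((_root_.turn m y).map (stLetter m n) ++ d.map (uL m n)), ?_, ?_, ?_⟩
  · simp [tProj_map_u, tProj_map_stLetter]
  · rw [← List.append_assoc P₁, uProj_append _ (sL m n :: l₂), hb, uProj_s_cons, hd,
      uProj_append, uProj_append, uProj_map_turn, uProj_map_u, uProj_map_u]
    rfl
  · rw [← List.append_assoc P₁, posVal_append _ (sL m n :: l₂), posVal_cons, hab, hcd,
      posVal_append, posVal_append, ← key, (commute_map_t_map_u a b).eq]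
    simp only [mul_assoc]

/-- The congruence on words in `s, t_1, …, t_m` given by mutual lifting. -/
def liftCon (m n : ℕ) : Con (FreeMonoid (Fin (m + 1))) where
  r a b := LiftsTo m n a.toList b.toList ∧ LiftsTo m n b.toList a.toList
  iseqv := ⟨fun _ => ⟨.refl _, .refl _⟩, fun h => ⟨h.2, h.1⟩,
    fun h h' => ⟨h.1.trans h'.1, h'.2.trans h.2⟩⟩
  mul' h h' := ⟨h.1.append h'.1, h.2.append h'.2⟩

/-- The normal form, modulo full turns, of a word in `s, t_1, …, t_m`. -/
def turnReduce (m : ℕ) (a : List (Fin (m + 1))) : List (Fin (m + 1)) :=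
  a.foldr (cyclePush (cycSucc m) m) []

/-- All turns coincide in the quotient by `liftCon`, so `list_prod_eq_of_foldr_cyclePush_eq` applies
with that quotient as target. -/
theorem LiftsTo.of_turnReduce_eq {a b : List (Fin (m + 1))} (hl : a.length = b.length)
    (h : turnReduce m a = turnReduce m b) : LiftsTo m n a b := by
  have e : ∀ a : List (Fin (m + 1)),
      (a.map fun x => ((FreeMonoid.of x : FreeMonoid (Fin (m + 1))) : (liftCon m n).Quotient)).prod
        = ((FreeMonoid.ofList a : FreeMonoid (Fin (m + 1))) : (liftCon m n).Quotient) := by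
    intro a
    induction a with
    | nil => rfl
    | cons x a ih => rw [List.map_cons, List.prod_cons, ih]; rfl
  have := list_prod_eq_of_foldr_cyclePush_eq (iterate_cycSucc_self m)
    (fun x => ((FreeMonoid.of x : FreeMonoid (Fin (m + 1))) : (liftCon m n).Quotient))
    ((FreeMonoid.ofList (_root_.turn m 0) : FreeMonoid (Fin (m + 1))) : (liftCon m n).Quotient)
    (fun x => (e _).trans ((Con.eq _).2 ⟨LiftsTo.turn x 0, LiftsTo.turn 0 x⟩)) hl h
  rw [e, e] at this
  exact ((Con.eq _).1 this).1

/-- The numerical and combinatorial invariants of a positive word that determine its value. -/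
def invariants (w : PosWord m n) :
    (ℕ × ℕ) × List (Fin (m + 1)) × List (Fin (n + 1)) :=
  (((tProj w).length, (uProj w).length), turnReduce m (tProj w), turnReduce n (uProj w))

/-- Lifting twice, the second time with t and u exchanged, corrects one projection of `P` and then
the other while preserving its value. -/
theorem posVal_eq_of_invariants_eq {P Q : PosWord m n} (h : invariants P = invariants Q) :
    posVal P = posVal Q := by
  simp only [invariants, Prod.mk.injEq] at h
  obtain ⟨⟨h1, h2⟩, h3, h4⟩ := h
  obtain ⟨R, hR, huR, hvR⟩ := LiftsTo.of_turnReduce_eq (n := n) h1 h3 P rfl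
  obtain ⟨S, hS, huS, hvS⟩ := LiftsTo.of_turnReduce_eq (n := m) h2 h4 (R.map (swapLetter m n)) huR
  have hvS' := posVal_map_swapLetter hvS
  rw [map_swapLetter_map_swapLetter] at hvS'
  rw [← hvR, ← hvS']
  apply posVal_eq_of_proj_eq
  · rw [uProj] at huS
    rw [huS, uProj, map_swapLetter_map_swapLetter, hR]
  · rw [uProj, map_swapLetter_map_swapLetter, hS]

end Monoid

/-! ### The invariants factor through the group -/

section Group

variable {m n : ℕ}

theorem localizationHom_posVal_letter (x : Letter m n) :
    localizationHom m n (posVal [x]) = PresentedGroup.of x := rfl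

theorem defRel_perm {a b : FreeMonoid (Letter m n)} (h : DefRel m n a b) :
    a.toList.Perm b.toList := by
  cases h with
  | cyc_t k => exact (List.rotate_perm _ k).symm
  | cyc_u k => exact (List.rotate_perm _ k).symm
  | comm i j => exact List.Perm.swap _ _ _

theorem exists_gmn_hom {H : Type*} [Group H] (f : Letter m n → H)
    (hf : ∀ a b, DefRel m n a b → (a.toList.map f).prod = (b.toList.map f).prod) :
    ∃ φ : Gmn m n →* H, ∀ w, φ (localizationHom m n (posVal w)) = (w.map f).prod := by
  have e : ∀ a, FreeGroup.lift f (freeMonoidToFreeGroup m n a) = (a.toList.map f).prod := by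
    intro a
    have : (FreeGroup.lift f).comp (freeMonoidToFreeGroup m n) = FreeMonoid.lift f := by
      ext x
      simp [freeMonoidToFreeGroup]
    rw [← FreeMonoid.lift_apply f, ← this]
    rfl
  have hr : ∀ r ∈ groupRelators m n, FreeGroup.lift f r = 1 := by
    rintro r ⟨a, b, hab, rfl⟩
    rw [map_mul, map_inv, e, e, hf a b hab, mul_inv_cancel]
  refine ⟨PresentedGroup.toGroup hr, fun w => ?_⟩
  induction w with
  | nil => simp [posVal_nil]
  | cons x w ih =>
    rw [posVal_cons, map_mul, map_mul, ih, localizationHom_posVal_letter, PresentedGroup.toGroup.of,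
      List.map_cons, List.prod_cons]

/-- Both sides of each relation have the same letter counts, so counting letters defines a
homomorphism to a free abelian group. -/
theorem perm_of_localizationHom_eq {P Q : PosWord m n}
    (h : localizationHom m n (posVal P) = localizationHom m n (posVal Q)) : P.Perm Q := by
  obtain ⟨φ, hφ⟩ := exists_gmn_hom
    (fun x : Letter m n => Multiplicative.ofAdd (Pi.single x 1 : Letter m n → ℤ))
    (fun a b hab => ((defRel_perm hab).map _).prod_eq)
  have e : ∀ (w : PosWord m n) (y : Letter m n),
      Multiplicative.toAdd (w.map
        fun x : Letter m n => Multiplicative.ofAdd (Pi.single x 1 : Letter m n → ℤ)).prod y =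
      ((w : Multiset (Letter m n)).count y : ℤ) := by
    intro w y
    induction w with
    | nil => simp
    | cons x w ih =>
      rw [List.map_cons, List.prod_cons, toAdd_mul, Pi.add_apply, ih, ← Multiset.cons_coe,
        Multiset.count_cons, toAdd_ofAdd, Pi.single_apply, Nat.cast_add, Nat.cast_ite, Nat.cast_one,
        Nat.cast_zero, add_comm]
  rw [← Multiset.coe_eq_coe]
  ext y
  have := congrArg (fun g => Multiplicative.toAdd (φ g) y) h
  simp only [hφ, e] at this
  exact_mod_cast this

/-- The group acts on cycle-free words, with s and t_i pushing and u_j acting trivially: t-turns act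
as the identity and rotations of the s,u-word all act as s. Applied to the empty word, `P` gives the
reduced form. -/
theorem turnReduce_tProj_eq_of_localizationHom_eq {P Q : PosWord m n}
    (h : localizationHom m n (posVal P) = localizationHom m n (posVal Q)) :
    turnReduce m (tProj P) = turnReduce m (tProj Q) := by
  let c := cyclePerm (iterate_cycSucc_self m)
  have e : ∀ w : PosWord m n,
      (w.map fun x => (stIndex m n x).elim 1 c).prod = ((tProj w).map c).prod := by
    intro w
    induction w with
    | nil => rfl
    | cons x w ih =>
      rw [List.map_cons, List.prod_cons, ih]
      induction x using letter_cases <;> simp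
  have hturn : ∀ k, (((tProj ((sL m n :: tWord m n).rotate k)).map c).prod) = 1 := by
    intro k
    obtain ⟨x, hx⟩ := s_cons_tWord_rotate (m := m) (n := n) k
    rw [hx, tProj_map_stLetter]
    exact cyclePerm_iterate_prod _ x
  have hone : ∀ k, tProj ((sL m n :: uWord m n).rotate k) = [0] := by
    intro k
    have h1 := (List.rotate_perm (sL m n :: uWord m n) k).filterMap (stIndex m n)
    have h2 : (sL m n :: uWord m n).filterMap (stIndex m n) = [0] := by
      change 0 :: tProj (uWord m n) = [0]
      rw [uWord, List.ofFn_eq_map, tProj_map_u]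
    rwa [h2, List.perm_singleton] at h1
  obtain ⟨φ, hφ⟩ := exists_gmn_hom (fun x : Letter m n => (stIndex m n x).elim 1 c) (by
    intro a b hab
    rw [e, e]
    cases hab with
    | cyc_t k =>
      have := hturn 0
      rw [List.rotate_zero] at this
      exact this.trans (hturn k).symm
    | cyc_u k =>
      have := hone 0
      rw [List.rotate_zero] at this
      rw [FreeMonoid.toList_ofList, FreeMonoid.toList_ofList, this, hone k]
    | comm i j => rfl)
  have h' := congrArg (fun g => (φ g ⟨[], cycleFree_nil⟩).1) h
  simp only [hφ, e] at h'
  rw [cyclePerm_list_prod, cyclePerm_list_prod] at h'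
  exact h'

theorem localizationHom_map_swapLetter_eq {P Q : PosWord m n}
    (h : localizationHom m n (posVal P) = localizationHom m n (posVal Q)) :
    localizationHom n m (posVal (P.map (swapLetter m n))) =
      localizationHom n m (posVal (Q.map (swapLetter m n))) := by
  have e : ∀ w : PosWord m n,
      (w.map fun x => localizationHom n m (posVal [swapLetter m n x])).prod =
      localizationHom n m (posVal (w.map (swapLetter m n))) := by
    intro w
    rw [posVal_eq_prod, map_list_prod, List.map_map, List.map_map]
    rfl
  obtain ⟨φ, hφ⟩ := exists_gmn_hom
    (fun x : Letter m n => localizationHom n m (posVal [swapLetter m n x])) (by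
      intro a b hab
      rw [e, e, posVal_map_swapLetter_of_defRel hab])
  have := congrArg φ h
  rwa [hφ, hφ, e, e] at this

theorem invariants_eq_of_localizationHom_eq {P Q : PosWord m n}
    (h : localizationHom m n (posVal P) = localizationHom m n (posVal Q)) :
    invariants P = invariants Q := by
  have hp := perm_of_localizationHom_eq h
  have h1 : (tProj P).length = (tProj Q).length := (hp.filterMap _).length_eq
  have h2 : (uProj P).length = (uProj Q).length := ((hp.map _).filterMap _).length_eq
  have h3 := turnReduce_tProj_eq_of_localizationHom_eq h
  have h4 : turnReduce n (uProj P) = turnReduce n (uProj Q) :=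
    turnReduce_tProj_eq_of_localizationHom_eq (localizationHom_map_swapLetter_eq h)
  rw [invariants, invariants, h1, h2, h3, h4]

theorem localizationHom_posVal_eq_iff {P Q : PosWord m n} :
    localizationHom m n (posVal P) = localizationHom m n (posVal Q) ↔ posVal P = posVal Q :=
  ⟨fun h => posVal_eq_of_invariants_eq (invariants_eq_of_localizationHom_eq h), congrArg _⟩

theorem posVal_eq_iff {P Q : PosWord m n} : posVal P = posVal Q ↔ invariants P = invariants Q :=
  ⟨fun h => invariants_eq_of_localizationHom_eq (congrArg _ h), posVal_eq_of_invariants_eq⟩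

theorem perm_of_posVal_eq {P Q : PosWord m n} (h : posVal P = posVal Q) : P.Perm Q :=
  perm_of_localizationHom_eq (congrArg _ h)

end Group

/-! ### Centrality of Δ and triviality of σ -/

section Fundamental

variable {m n : ℕ}

theorem commute_tWord_uWord : Commute (posVal (tWord m n)) (posVal (uWord m n)) := by
  rw [tWord, uWord, List.ofFn_eq_map, List.ofFn_eq_map]
  exact commute_map_t_map_u _ _

theorem Delta_eq_turn (x : Fin (m + 1)) :
    Delta m n = posVal ((turn m x).map (stLetter m n)) * posVal (uWord m n) := by
  rw [posVal_map_turn, ← posVal_append]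
  rfl

theorem commute_stLetter_uWord (x : Fin (m + 1)) :
    Commute (posVal [stLetter m n x]) (posVal (uWord m n)) := by
  cases x using Fin.cases with
  | zero =>
    have := posVal_s_cons_uWord_rotate (m := m) (n := n) 1
    rw [List.rotate_cons_succ, List.rotate_zero, posVal_append, posVal_cons _ (uWord m n)] at this
    exact this.symm
  | succ i =>
    rw [uWord, List.ofFn_eq_map]
    exact commute_map_t_map_u [i] _

/-- The cofactor is the rest of the turn followed by u_1⋯u_n; the latter commutes with s by a cyclic
relation and with each t_i. -/
theorem exists_cofactor_stLetter (x : Fin (m + 1)) : ∃ w : PosWord m n,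
    posVal (stLetter m n x :: w) = Delta m n ∧ posVal (w ++ [stLetter m n x]) = Delta m n := by
  refine ⟨(List.iterate (cycSucc m) (cycSucc m x) m).map (stLetter m n) ++ uWord m n, ?_, ?_⟩
  · rw [Delta_eq_turn x, ← posVal_append]
    rfl
  · rw [Delta_eq_turn (cycSucc m x), turn, List.iterate_add, ← Function.iterate_succ_apply,
      iterate_cycSucc_self, posVal_append, posVal_append, mul_assoc,
      ← (commute_stLetter_uWord x).eq, ← mul_assoc, ← posVal_append, List.map_append]
    rfl

theorem exists_cofactor (x : Letter m n) : ∃ w : PosWord m n,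
    posVal (x :: w) = Delta m n ∧ posVal (w ++ [x]) = Delta m n := by
  induction x using letter_cases with
  | s => exact exists_cofactor_stLetter 0
  | t i => exact exists_cofactor_stLetter i.succ
  | u j =>
    obtain ⟨w, h1, h2⟩ := exists_cofactor_stLetter (m := n) (n := m) j.succ
    -- Exchanging t and u fixes Δ, as t_1⋯t_m and u_1⋯u_n commute.
    have h3 : posVal ((sL n m :: (tWord n m ++ uWord n m)).map (swapLetter n m)) = Delta m n := by
      rw [List.map_cons, List.map_append, map_swapLetter_tWord, map_swapLetter_uWord,
        swapLetter_s, posVal_cons, posVal_append, ← commute_tWord_uWord.eq, ← posVal_append,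
        ← posVal_cons]
      rfl
    refine ⟨w.map (swapLetter n m), ?_, ?_⟩
    · rw [← h3, ← posVal_map_swapLetter h1]
      rfl
    · rw [← h3, ← posVal_map_swapLetter h2, List.map_append]
      rfl

theorem isFundamentalPerm_one : IsFundamentalPerm (Delta m n) 1 := by
  intro x
  obtain ⟨w, h1, h2⟩ := exists_cofactor x
  exact ⟨posVal w, by rw [← h1, posVal_cons], by rw [← h2, posVal_append]; rfl⟩

theorem commute_letter_Delta (x : Letter m n) : Commute (posVal [x]) (Delta m n) := by
  obtain ⟨w, h1, h2⟩ := exists_cofactor x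
  rw [Commute, SemiconjBy, ← h1]
  conv_lhs => rw [h1, ← h2]
  rw [posVal_append, posVal_cons x w, mul_assoc]

/-- Centrality of Δ = x D gives x D = D x in the group. Comparing with x D = D σ(x) and cancelling D
gives σ(x) = x there, and letter counts separate letters. -/
theorem IsFundamentalPerm.eq_one {σ : Equiv.Perm (Letter m n)}
    (h : IsFundamentalPerm (Delta m n) σ) : σ = 1 := by
  ext1 x
  obtain ⟨D, h1, h2⟩ := h x
  have hc : posVal [x] * Delta m n = Delta m n * posVal [x] := commute_letter_Delta x
  have h3 := congrArg (localizationHom m n) (h1.symm.trans h2)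
  conv at hc => lhs; rw [h1]
  conv at hc => rhs; rw [h1]
  replace hc := congrArg (localizationHom m n) hc
  rw [map_mul, map_mul] at h3
  simp only [map_mul, mul_assoc, mul_right_inj] at hc
  rw [h3, mul_right_inj] at hc
  exact List.singleton_perm_singleton.1
    (perm_of_localizationHom_eq (P := [σ x]) (Q := [x]) hc)

theorem Delta_mem_center : Delta m n ∈ Submonoid.center (GPlus m n) := by
  rw [Submonoid.mem_center_iff]
  intro g
  obtain ⟨w, rfl⟩ := posVal_surjective g
  induction w with
  | nil => rw [posVal_nil, one_mul, mul_one]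
  | cons x w ih =>
    rw [posVal_cons]
    exact (commute_letter_Delta x).mul_left ih

theorem localizationHom_Delta_mem_center :
    localizationHom m n (Delta m n) ∈ Subgroup.center (Gmn m n) := by
  rw [← Subgroup.centralizer_univ, ← Subgroup.coe_top,
    ← PresentedGroup.closure_range_of (groupRelators m n), Subgroup.centralizer_closure,
    Subgroup.mem_centralizer_iff]
  rintro _ ⟨x, rfl⟩
  have := congrArg (localizationHom m n) (commute_letter_Delta x).eq
  rwa [map_mul, map_mul, localizationHom_posVal_letter] at this

end Fundamental

/-! ### Computability and the word problem -/

section Algorithms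

variable {m n : ℕ}

theorem primrec_turnReduce (m : ℕ) : Primrec (turnReduce m) := by
  have h : Primrec₂ (cyclePush (cycSucc m) m) := by
    have hd : Primrec fun p : Fin (m + 1) × List (Fin (m + 1)) => p.2.drop m :=
      Primrec.list_drop.comp (Primrec.const m) Primrec.snd
    refine Primrec.ite (Primrec.eq.comp (Primrec.list_append.comp ?_ hd) Primrec.snd) hd
      (Primrec.list_cons.comp Primrec.fst Primrec.snd)
    exact (Primrec.dom_finite fun x => List.iterate (cycSucc m) (cycSucc m x) m).comp Primrec.fst
  exact Primrec.list_foldr Primrec.id (Primrec.const [])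
    (h.comp (Primrec.fst.comp Primrec.snd) (Primrec.snd.comp Primrec.snd)).to₂

theorem primrec_tProj : Primrec (tProj : PosWord m n → List (Fin (m + 1))) :=
  Primrec.listFilterMap Primrec.id ((Primrec.dom_finite (stIndex m n)).comp Primrec.snd).to₂

theorem primrec_uProj : Primrec (uProj : PosWord m n → List (Fin (n + 1))) :=
  primrec_tProj.comp
    (Primrec.list_map Primrec.id ((Primrec.dom_finite (swapLetter m n)).comp Primrec.snd).to₂)

theorem primrec_invariants : Primrec (invariants (m := m) (n := n)) :=
  ((Primrec.list_length.comp primrec_tProj).pair (Primrec.list_length.comp primrec_uProj)).pair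
    (((primrec_turnReduce m).comp primrec_tProj).pair ((primrec_turnReduce n).comp primrec_uProj))

/-- The list of the words of length `k` over a finite alphabet. -/
noncomputable def wordsOfLength (α : Type*) [Fintype α] (k : ℕ) : List (List α) :=
  k.rec [[]] fun _ l => l.flatMap fun w => Finset.univ.toList.map fun x => x :: w

theorem mem_wordsOfLength {α : Type*} [Fintype α] {k : ℕ} {w : List α} :
    w ∈ wordsOfLength α k ↔ w.length = k := by
  induction k generalizing w with
  | zero => simp [wordsOfLength]
  | succ k ih =>
    change w ∈ (wordsOfLength α k).flatMap _ ↔ _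
    cases w <;> simp [ih]

theorem primrec_wordsOfLength (α : Type*) [Fintype α] [Primcodable α] :
    Primrec (wordsOfLength α) :=
  Primrec.nat_rec₁ _ (Primrec.list_flatMap Primrec.snd
    (Primrec.list_map (Primrec.const _)
      (Primrec.list_cons.comp Primrec.snd (Primrec.snd.comp Primrec.fst)).to₂).to₂).to₂

/-- The list of the positive words with the same value as a given one. -/
noncomputable def equalWords (P : PosWord m n) : List (PosWord m n) :=
  (wordsOfLength (Letter m n) P.length).flatMap fun Q =>
    if invariants Q = invariants P then [Q] else []

theorem mem_equalWords {P Q : PosWord m n} : Q ∈ equalWords P ↔ posVal Q = posVal P := by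
  have : Q ∈ equalWords P ↔ Q.length = P.length ∧ invariants Q = invariants P := by
    rw [equalWords, List.mem_flatMap]
    constructor
    · rintro ⟨R, hR, h⟩
      split_ifs at h with hi
      · obtain rfl := List.mem_singleton.1 h
        exact ⟨mem_wordsOfLength.1 hR, hi⟩
      · simp at h
    · rintro ⟨hl, hi⟩
      exact ⟨Q, mem_wordsOfLength.2 hl, by simp [hi]⟩
  rw [this, ← posVal_eq_iff, and_iff_right_iff_imp]
  -- Equal values force equal lengths, so the search misses nothing.
  exact fun h => (perm_of_posVal_eq h).length_eq

theorem primrec_equalWords : Primrec (equalWords (m := m) (n := n)) :=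
  Primrec.list_flatMap ((primrec_wordsOfLength _).comp Primrec.list_length)
    (Primrec.ite (Primrec.eq.comp (primrec_invariants.comp Primrec.snd)
        (primrec_invariants.comp Primrec.fst))
      (Primrec.list_cons.comp Primrec.snd (Primrec.const [])) (Primrec.const [])).to₂

/-- A positive word that becomes `Δ` when multiplied by the letter `x` on either side. -/
noncomputable def cofactor (x : Letter m n) : PosWord m n := (exists_cofactor x).choose

/-- Replacement of each inverse letter `x⁻¹` by the cofactor of `x`. -/
noncomputable def clearInverses (U : GroupWord m n) : PosWord m n :=
  U.flatMap fun p => if p.2 then [p.1] else cofactor p.1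

/-- A word for the power of `Δ` whose exponent is the number of inverse letters. -/
def inversesDelta (U : GroupWord m n) : PosWord m n :=
  U.flatMap fun p => if p.2 then [] else sL m n :: (tWord m n ++ uWord m n)

/-- The number of inverse letters. -/
def inversesCount (U : GroupWord m n) : ℕ :=
  (U.flatMap fun p => if p.2 then [] else [()]).length

theorem posVal_inversesDelta (U : GroupWord m n) :
    posVal (inversesDelta U) = Delta m n ^ inversesCount U := by
  induction U with
  | nil => rfl
  | cons p U ih =>
    unfold inversesDelta inversesCount at ih ⊢
    rw [List.flatMap_cons, List.flatMap_cons, posVal_append, ih, List.length_append, pow_add]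
    obtain ⟨x, _ | _⟩ := p
    · simp [Delta]
    · simp [posVal_nil]

theorem groupVal_cons (p : Letter m n × Bool) (U : GroupWord m n) :
    groupVal (p :: U) = groupVal [p] * groupVal U := by
  unfold groupVal
  rw [← map_mul, FreeGroup.mul_mk]
  rfl

/-- The cofactor of x equals Δ x⁻¹ in the group, and the central factors Δ collect in front. -/
theorem localizationHom_clearInverses (U : GroupWord m n) :
    localizationHom m n (posVal (clearInverses U)) =
      localizationHom m n (Delta m n) ^ inversesCount U * groupVal U := by
  induction U with
  | nil =>
    change localizationHom m n 1 = _ ^ 0 * PresentedGroup.mk _ 1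
    simp
  | cons p U ih =>
    unfold clearInverses inversesCount at ih ⊢
    rw [List.flatMap_cons, List.flatMap_cons, posVal_append, map_mul, ih, List.length_append,
      pow_add, groupVal_cons]
    have hc : ∀ (g : Gmn m n) (k : ℕ), g * localizationHom m n (Delta m n) ^ k =
        localizationHom m n (Delta m n) ^ k * g := fun g k =>
      Subgroup.mem_center_iff.1 (pow_mem localizationHom_Delta_mem_center k) g
    have key : localizationHom m n (posVal (if p.2 then [p.1] else cofactor p.1)) =
        localizationHom m n (Delta m n) ^ (if p.2 then [] else [()]).length * groupVal [p] := by
      obtain ⟨x, _ | _⟩ := p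
      · have hx := congrArg (localizationHom m n) (exists_cofactor x).choose_spec.2
        rw [posVal_append, map_mul] at hx
        change localizationHom m n (posVal (cofactor x)) =
          localizationHom m n (Delta m n) ^ 1 * (PresentedGroup.of x)⁻¹
        rw [pow_one]
        exact eq_mul_inv_of_mul_eq hx
      · change PresentedGroup.of x =
          localizationHom m n (Delta m n) ^ 0 * PresentedGroup.of x
        rw [pow_zero, one_mul]
    rw [key, mul_assoc, ← mul_assoc (groupVal [p]), hc]
    simp only [mul_assoc]

/-- Two group words are made positive by a common power of `Δ`. -/
noncomputable def makePositive (p : GroupWord m n × GroupWord m n) :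
    ℕ × (PosWord m n × PosWord m n) :=
  -- Each word is padded with the power of Δ that the other one needs, so that the exponents agree.
  (inversesCount p.1 + inversesCount p.2,
    (inversesDelta p.2 ++ clearInverses p.1, inversesDelta p.1 ++ clearInverses p.2))

theorem makePositive_spec (U V : GroupWord m n) :
    localizationHom m n (posVal (makePositive (U, V)).2.1) =
        localizationHom m n (Delta m n) ^ (makePositive (U, V)).1 * groupVal U ∧
      localizationHom m n (posVal (makePositive (U, V)).2.2) =
        localizationHom m n (Delta m n) ^ (makePositive (U, V)).1 * groupVal V := by
  simp only [makePositive, posVal_append, posVal_inversesDelta, map_mul, map_pow,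
    localizationHom_clearInverses, ← mul_assoc, ← pow_add, and_true]
  rw [add_comm]

/-- A function on a finite alphabet is a finite table, so even cofactors obtained by choice give an
algorithm. -/
theorem primrec_flatMap_of_finite {α β : Type*} [Finite α] [Primcodable α] [Primcodable β]
    (f : α → List β) : Primrec fun l : List α => l.flatMap f :=
  Primrec.list_flatMap Primrec.id ((Primrec.dom_finite f).comp Primrec.snd).to₂

theorem primrec_makePositive : Primrec (makePositive (m := m) (n := n)) := by
  have h1 : Primrec (clearInverses (m := m) (n := n)) := primrec_flatMap_of_finite _
  have h2 : Primrec (inversesDelta (m := m) (n := n)) := primrec_flatMap_of_finite _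
  have h3 : Primrec (inversesCount (m := m) (n := n)) :=
    Primrec.list_length.comp (primrec_flatMap_of_finite _)
  exact (Primrec.nat_add.comp (h3.comp Primrec.fst) (h3.comp Primrec.snd)).pair
    ((Primrec.list_append.comp (h2.comp Primrec.snd) (h1.comp Primrec.fst)).pair
      (Primrec.list_append.comp (h2.comp Primrec.fst) (h1.comp Primrec.snd)))

theorem groupVal_eq_iff {U V : GroupWord m n} {k : ℕ} {P Q : PosWord m n}
    (hP : localizationHom m n (posVal P) = localizationHom m n (Delta m n) ^ k * groupVal U)
    (hQ : localizationHom m n (posVal Q) = localizationHom m n (Delta m n) ^ k * groupVal V) :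
    groupVal U = groupVal V ↔ posVal P = posVal Q := by
  rw [← localizationHom_posVal_eq_iff, hP, hQ, mul_right_inj]

theorem computablePred_groupVal_eq :
    ComputablePred fun p : GroupWord m n × GroupWord m n => groupVal p.1 = groupVal p.2 := by
  have h : PrimrecPred fun p : GroupWord m n × GroupWord m n =>
      invariants (makePositive p).2.1 = invariants (makePositive p).2.2 :=
    Primrec.eq.comp
      (primrec_invariants.comp (Primrec.fst.comp (Primrec.snd.comp primrec_makePositive)))
      (primrec_invariants.comp (Primrec.snd.comp (Primrec.snd.comp primrec_makePositive)))
  obtain ⟨d, hd⟩ := h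
  refine ComputablePred.of_eq ⟨d, hd.to_comp⟩ fun p => ?_
  obtain ⟨hU, hV⟩ := makePositive_spec p.1 p.2
  rw [groupVal_eq_iff hU hV, posVal_eq_iff]

end Algorithms

theorem proposition5p2 (m n : ℕ) :
    -- the word problem in `G_{m,n}` is solvable
    ComputablePred (fun p : GroupWord m n × GroupWord m n => groupVal p.1 = groupVal p.2) ∧
    -- `Δ` is a fundamental element, with a well-defined permutation `σ`
    (∃! σ : Equiv.Perm (Letter m n), IsFundamentalPerm (Delta m n) σ) ∧
    (∀ σ : Equiv.Perm (Letter m n), IsFundamentalPerm (Delta m n) σ →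
      -- `Λ = Δ ^ ord σ` is central
      Delta m n ^ orderOf σ ∈ Submonoid.center (GPlus m n) ∧
      localizationHom m n (Delta m n ^ orderOf σ) ∈ Subgroup.center (Gmn m n) ∧
      -- two group words are made positive, by an algorithm, by the same power of `Λ`
      (∃ pos : GroupWord m n × GroupWord m n → ℕ × (PosWord m n × PosWord m n),
        Computable pos ∧
        ∀ U V : GroupWord m n,
          localizationHom m n (posVal (pos (U, V)).2.1) =
            localizationHom m n (Delta m n ^ orderOf σ) ^ (pos (U, V)).1 * groupVal U ∧
          localizationHom m n (posVal (pos (U, V)).2.2) =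
            localizationHom m n (Delta m n ^ orderOf σ) ^ (pos (U, V)).1 * groupVal V) ∧
      -- equality of the group words is equality of the positive words in `G⁺_{m,n}`
      (∀ (U V : GroupWord m n) (k : ℕ) (P Q : PosWord m n),
        localizationHom m n (posVal P) =
          localizationHom m n (Delta m n ^ orderOf σ) ^ k * groupVal U →
        localizationHom m n (posVal Q) =
          localizationHom m n (Delta m n ^ orderOf σ) ^ k * groupVal V →
        (groupVal U = groupVal V ↔ posVal P = posVal Q))) ∧
    -- the positive words equivalent to a given one are finite in number and can be enumerated
    (∃ enum : PosWord m n → List (PosWord m n), Computable enum ∧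
      ∀ P Q : PosWord m n, Q ∈ enum P ↔ posVal Q = posVal P) := by
  refine ⟨computablePred_groupVal_eq,
    ⟨1, isFundamentalPerm_one, fun σ hσ => hσ.eq_one⟩, fun σ hσ => ?_,
    equalWords, primrec_equalWords.to_comp, fun _ _ => mem_equalWords⟩
  -- Since σ = 1 has order 1, Λ is Δ itself.
  rw [hσ.eq_one, orderOf_one, pow_one]
  exact ⟨Delta_mem_center, localizationHom_Delta_mem_center,
    ⟨makePositive, primrec_makePositive.to_comp, makePositive_spec⟩,
    fun _ _ _ _ _ hP hQ => groupVal_eq_iff hP hQ⟩
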